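/- **Definitions.** All graphs are simple with vertex set $[n]=\{1,\dots,n\}$. *Generalized graph shift.* Let $x\neq y$ be two vertices of $G_1$ that are not contained in one cycle of $G_1$, joined by a path $P$ all of whose interior vertices (if any) have degree $2$ in $G_1$, and let $w$ be the neighbour of $y$ on $P$. If $G_2$ is the graph obtained from $G_1$ by moving all neighbours of $y$ except $w$ to $x$ (each edge $yu$ with $u\ne w$ is replaced by $xu$), we write $G_2=\mathrm{GGS}(G_1)$. *Orientations.* For $B\subseteq[n]$, a $B$-orientation $O$ of $G$ assigns to each vertex $v\in B$ an arrow pointing from $v$ to one of its neighbours $O(v)$ in $G$ (which may or may not lie in $B$). It has type $\mu=(1^{n_1},2^{n_2},3^{n_3},\dots)\vdash n$ if it has exactly $n_2$ bidirected edges (edges with two arrows) and, for each $i\ge 3$, exactly $n_i$ directed $i$-cycles; so $n_1$ is the number of vertices of $[n]$ lying on no bidirected edge and no directed cycle. Let $a_{G,r}(\mu)$ be the number of $B$-orientations of $G$ of type $\mu$, over all $B\subseteq[n]$ with $|B|=r$. *Coefficients.* For $\lambda\vdash n$ let $\chi_\lambda$ be the irreducible character of the symmetric group $\mathfrak S_n$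 over $\mathbb C$ indexed by $\lambda$ (the character of the Specht module $S^\lambda$), and let $\mathrm{imm}_\lambda(A)=\sum_{\psi\in\mathfrak S_n}\chi_\lambda(\psi)\prod_{i=1}^n a_{i,\psi(i)}$. Let $L_G=D-A(G)$ be the Laplacian matrix of $G$, and define $b_{\lambda,r}(L_G)$, $0\le r\le n$, by $$\mathrm{imm}_\lambda(xI-L_G)=\sum_{r=0}^n(-1)^r\,b_{\lambda,r}(L_G)\,x^{n-r}.$$ **Theorem 5.3.** Let $G_1$ and $G_2$ be two bipartite graphs with $n$ vertices such that $G_2=\mathrm{GGS}(G_1)$. Then for all $r\ge 0$ and all partitions $\mu$ of $n$, $$a_{G_2,r}(\mu)\le a_{G_1,r}(\mu).$$ Consequently, for all $\lambda\vdash n$ and all $0\le r\le n$, the numbers $b_{\lambda,r}(L_{G_1})$ and $b_{\lambda,r}(L_{G_2})$ are real and $$b_{\lambda,r}(L_{G_2})\le b_{\lambda,r}(L_{G_1}).$$ -/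

import Mathlib

open Polynomial

noncomputable section

/-! ### Irreducible characters of the symmetric group (Specht modules) -/

/-- The Young diagram of a partition `lam` of `n`: its rows are the parts of `lam` in
weakly decreasing order. -/
def partitionDiagram {n : ℕ} (lam : n.Partition) : YoungDiagram :=
  YoungDiagram.ofRowLens (lam.parts.sort (· ≥ ·))
    (List.sortedGE_iff_pairwise.mpr (Multiset.pairwise_sort lam.parts (· ≥ ·)))

/-- A (bijective) Young tableau of shape `lam`: a filling of the cells of the diagram with the
`n` elements of `Fin n`, each used exactly once. -/
abbrev YTableau {n : ℕ} (lam : n.Partition) : Type :=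
  {c : ℕ × ℕ // c ∈ partitionDiagram lam} ≃ Fin n

/-- The index of the row of `T` that contains `v`. The function `T.rowOf` determines, and is
determined by, the tabloid `{T}` (the row equivalence class of `T`). -/
def YTableau.rowOf {n : ℕ} {lam : n.Partition} (T : YTableau lam) (v : Fin n) : ℕ :=
  (T.symm v).1.1

/-- The index of the column of `T` that contains `v`. -/
def YTableau.colOf {n : ℕ} {lam : n.Partition} (T : YTableau lam) (v : Fin n) : ℕ :=
  (T.symm v).1.2

/-- The permutation representation of `𝔖ₙ` on the free complex vector space over all functions
`Fin n → ℕ`; a tabloid is encoded by its row function, and `σ • {T} = {σT}` has the row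
function `rowOf T ∘ σ⁻¹`. -/
def tabloidRep (n : ℕ) :
    Representation ℂ (Equiv.Perm (Fin n)) ((Fin n → ℕ) →₀ ℂ) where
  toFun σ := Finsupp.lmapDomain ℂ ℂ (fun f : Fin n → ℕ => f ∘ ⇑(σ⁻¹))
  map_one' := by
    ext f
    simp
  map_mul' σ τ := by
    refine Finsupp.lhom_ext fun f a => ?_
    rw [Module.End.mul_apply]
    simp only [Finsupp.lmapDomain_apply, Finsupp.mapDomain_single, mul_inv_rev]
    rfl

open Classical in
/-- The polytabloid `e_T = ∑ sgn(σ) {σT}`, the sum running over the column stabilizer of `T`. -/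
def polytabloid {n : ℕ} {lam : n.Partition} (T : YTableau lam) : (Fin n → ℕ) →₀ ℂ :=
  ∑ σ : Equiv.Perm (Fin n) with ∀ v, T.colOf (σ v) = T.colOf v,
    Finsupp.single (T.rowOf ∘ ⇑(σ⁻¹)) ((Equiv.Perm.sign σ : ℤ) : ℂ)

theorem tabloidRep_polytabloid {n : ℕ} {lam : n.Partition} (τ : Equiv.Perm (Fin n))
    (T : YTableau lam) : tabloidRep n τ (polytabloid T) = polytabloid (T.trans τ) := by
  classical
  unfold polytabloid
  rw [map_sum]
  refine Finset.sum_bij' (fun σ _ => τ * σ * τ⁻¹) (fun σ _ => τ⁻¹ * σ * τ) ?_ ?_ ?_ ?_ ?_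
  · intro σ hσ
    simp only [Finset.mem_filter, Finset.mem_univ, true_and] at hσ ⊢
    intro v
    have := hσ (τ⁻¹ v)
    simpa [YTableau.colOf] using this
  · intro σ hσ
    simp only [Finset.mem_filter, Finset.mem_univ, true_and] at hσ ⊢
    intro v
    have := hσ (τ v)
    simpa [YTableau.colOf] using this
  · intro σ _
    group
  · intro σ _
    group
  · intro σ _
    have h1 : (T.rowOf ∘ ⇑(σ⁻¹)) ∘ ⇑(τ⁻¹)
        = YTableau.rowOf (lam := lam) (T.trans τ) ∘ ⇑((τ * σ * τ⁻¹)⁻¹) := by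
      funext v
      simp [YTableau.rowOf, mul_assoc]
    have h2 : Equiv.Perm.sign (τ * σ * τ⁻¹) = Equiv.Perm.sign σ := by
      rw [map_mul, map_mul, map_inv, mul_right_comm, mul_inv_cancel, one_mul]
    change Finsupp.lmapDomain ℂ ℂ _ _ = _
    rw [Finsupp.lmapDomain_apply, Finsupp.mapDomain_single, h1, h2]

/-- The Specht module `S^lam`: the span of all polytabloids of shape `lam`. -/
def spechtModule {n : ℕ} (lam : n.Partition) : Submodule ℂ ((Fin n → ℕ) →₀ ℂ) :=
  Submodule.span ℂ (Set.range (polytabloid (lam := lam)))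

theorem tabloidRep_mem_spechtModule {n : ℕ} (lam : n.Partition) (τ : Equiv.Perm (Fin n)) :
    ∀ v ∈ spechtModule lam, tabloidRep n τ v ∈ spechtModule lam := by
  intro v hv
  have hle : spechtModule lam ≤ (spechtModule lam).comap (tabloidRep n τ) := by
    unfold spechtModule
    rw [Submodule.span_le]
    rintro _ ⟨T, rfl⟩
    change tabloidRep n τ (polytabloid T) ∈ Submodule.span ℂ _
    rw [tabloidRep_polytabloid]
    exact Submodule.subset_span ⟨_, rfl⟩
  exact hle hv

/-- The irreducible character `χ_lam` of `𝔖ₙ` over `ℂ` indexed by the partition `lam`: the trace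
of the action of `σ` on the Specht module `S^lam` (which is finite-dimensional). -/
def irrChar {n : ℕ} (lam : n.Partition) (σ : Equiv.Perm (Fin n)) : ℂ :=
  LinearMap.trace ℂ (spechtModule lam)
    ((tabloidRep n σ).restrict (tabloidRep_mem_spechtModule lam σ))

/-! ### Immanants and Laplacian immanantal polynomials -/

/-- The immanant `imm_lam(A) = ∑_ψ χ_lam(ψ) ∏ᵢ A i (ψ i)` of an `n × n` matrix over a
commutative `ℂ`-algebra. -/
def immanant {n : ℕ} (lam : n.Partition) {R : Type*} [CommRing R] [Algebra ℂ R]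
    (A : Matrix (Fin n) (Fin n) R) : R :=
  ∑ ψ : Equiv.Perm (Fin n), irrChar lam ψ • ∏ i, A i (ψ i)

/-- The immanantal polynomial `φ_lam(A, x) = imm_lam(xI - A)`. -/
def immanantalPolynomial {n : ℕ} (lam : n.Partition) (A : Matrix (Fin n) (Fin n) ℂ) : ℂ[X] :=
  immanant lam (Matrix.charmatrix A)

/-- `b_{lam,r}(A)` for `0 ≤ r ≤ n`: the coefficient of `(-1)^r x^(n-r)` in `φ_lam(A, x)`. -/
def immanantalCoeff {n : ℕ} (lam : n.Partition) (r : ℕ) (A : Matrix (Fin n) (Fin n) ℂ) : ℂ :=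
  (-1) ^ r * (immanantalPolynomial lam A).coeff (n - r)

/-! ### Vertex orientations -/

/-- `O` is a `B`-orientation in `G`: each vertex `v ∈ B` is assigned an arrow `v → O v` along an
edge of `G` at `v`, and the vertices outside `B` get no arrow (`O v = none`). -/
def IsBOrientation {n : ℕ} (G : SimpleGraph (Fin n)) (B : Finset (Fin n))
    (O : Fin n → Option (Fin n)) : Prop :=
  (∀ v, (O v).isSome ↔ v ∈ B) ∧ ∀ v u, O v = some u → G.Adj v u

/-- `c` is a directed cycle of `O`: a cyclic permutation `v₁ ↦ v₂ ↦ ⋯ ↦ vᵢ ↦ v₁` of `i ≥ 2`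
distinct vertices (its support), each of which has its arrow pointing to the next one.
For `i = 2` this is an edge with two arrows on it. -/
def IsDirectedCycle {n : ℕ} (O : Fin n → Option (Fin n)) (c : Equiv.Perm (Fin n)) : Prop :=
  c.IsCycle ∧ ∀ v ∈ c.support, O v = some (c v)

open Classical in
/-- The number of directed cycles of length `i` in `O` (bidirected edges if `i = 2`). -/
def numDirectedCycles {n : ℕ} (O : Fin n → Option (Fin n)) (i : ℕ) : ℕ :=
  (Finset.univ.filter fun c : Equiv.Perm (Fin n) =>
    IsDirectedCycle O c ∧ c.support.card = i).card

/-- `O` has type `mu = (1^{n₁}, 2^{n₂}, …)`: for every `i ≥ 2`, the multiplicity `nᵢ` of `i` in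
`mu` is the number of directed `i`-cycles of `O`. Since `mu` is a partition of `n`, the
multiplicity `n₁` is then the number of vertices that lie on no directed cycle. -/
def HasType {n : ℕ} (O : Fin n → Option (Fin n)) (mu : n.Partition) : Prop :=
  ∀ i, 2 ≤ i → mu.parts.count i = numDirectedCycles O i

open Classical in
/-- `O_{G,r}(mu)`: all `B`-orientations of type `mu` in `G`, for all vertex sets `B` of size `r`. -/
def orientations {n : ℕ} (G : SimpleGraph (Fin n)) (r : ℕ) (mu : n.Partition) :
    Finset (Fin n → Option (Fin n)) :=
  Finset.univ.filter fun O =>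
    (∃ B : Finset (Fin n), B.card = r ∧ IsBOrientation G B O) ∧ HasType O mu

/-- `a_{G,r}(mu) = |O_{G,r}(mu)|`. -/
def numOrientations {n : ℕ} (G : SimpleGraph (Fin n)) (r : ℕ) (mu : n.Partition) : ℕ :=
  (orientations G r mu).card

/-! ### The generalized graph shift -/

/-- The graph obtained from `G` by moving all neighbours of `y` except `w` to the vertex `x`:
every edge `yu` with `u ≠ w` is replaced by the edge `xu`. -/
def moveNeighbors {V : Type*} (G : SimpleGraph V) (x y w : V) : SimpleGraph V :=
  SimpleGraph.fromEdgeSet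
    ((G.edgeSet \ {e | ∃ u, G.Adj y u ∧ u ≠ w ∧ e = s(y, u)}) ∪
      {e | ∃ u, G.Adj y u ∧ u ≠ w ∧ e = s(x, u)})

/-- `G₂ = GGS(G₁)`: there are distinct vertices `x` (the recipient) and `y` (the donor) of `G₁`,
not contained in one cycle of `G₁`, and a path from `x` to `y` all of whose interior vertices have
degree `2`, such that `G₂` is obtained from `G₁` by moving all neighbours of `y`, except the one on
the path, to `x`. -/
def IsGGS {V : Type*} [Fintype V] (G₁ G₂ : SimpleGraph V) [DecidableRel G₁.Adj] : Prop :=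
  ∃ (x y : V) (p : G₁.Walk x y), x ≠ y ∧ p.IsPath ∧
    (∀ v ∈ p.support, v ≠ x → v ≠ y → G₁.degree v = 2) ∧
    (∀ (z : V) (c : G₁.Walk z z), c.IsCycle → ¬ (x ∈ c.support ∧ y ∈ c.support)) ∧
    G₂ = moveNeighbors G₁ x y p.penultimate

end

/-!
Expanding `imm_lam(xI - (D + A))` over permutations and then over the arrows chosen at the vertices
shows that its coefficients are `∑ mu, a_{G,r}(mu) * w mu`, where `w mu` is the sum of `χ_lam` over
all permutations that move vertices only along the arrows of a fixed orientation of type `mu`. These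
are the products of subsets of its directed cycles, so `w mu` depends on `mu` only. On this set `E`
of permutations the cycle type of `ψ φ⁻¹` is read off the symmetric difference of two sets of
cycles, hence `|E| * w mu = ∑ ψ ∈ E, ∑ φ ∈ E, χ_lam (ψ φ⁻¹)`, which is the trace of `T T*` for
`T = ∑ ψ ∈ E, ρ ψ` with `ρ` unitary, and `0 ≤ w mu`.

It remains to compare the numbers `a_{G,r}(mu)`. An orientation of the shifted graph becomes one of
the original graph by moving the bunch at `x` back to the other end `y` of the path; if the arrow at
`x` points into the bunch, the path is reversed at the same time, so that this arrow starts at `y`.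
The map is injective, and it conjugates the directed cycles because the arrows cross the boundary
of the relabelled region in one direction only.

For bipartite graphs, `D - A` and `D + A` are conjugate by the diagonal matrix of the signs of the
colour classes, which does not change the immanants.
-/

section Arrows

variable {V : Type*}

/-- The permutation `ψ` follows the arrows of `O`: it moves vertices only along arrows. Directed
cycles are the cyclic permutations with this property. -/
def Follows (O : V → Option V) (ψ : Equiv.Perm V) : Prop :=
  ∀ v, ψ v ≠ v → O v = some (ψ v)

/-- The arrows of `O` cross the boundary of `Z` in at most one direction. -/
def IsOneWay (Z : Set V) (O : V → Option V) : Prop :=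
  (∀ v ∈ Z, ∀ w, O v = some w → w ∈ Z) ∨ ∀ v ∉ Z, ∀ w, O v = some w → w ∉ Z

open Classical in
/-- The arrows starting in `Z` are relabelled by `τ`, at both ends; the other arrows are kept.
This is meant for `τ` preserving `Z`, but an arrow leaving `Z` has its head moved by `τ` too. -/
noncomputable def transport (τ : Equiv.Perm V) (Z : Set V) (O : V → Option V) (v : V) : Option V :=
  if v ∈ Z then (O (τ.symm v)).map τ else O v

variable {O O' : V → Option V} {Z : Set V} {σ τ ψ : Equiv.Perm V}

theorem Follows.mapsTo (hψ : Follows O ψ) (hO : ∀ v ∈ Z, ∀ w, O v = some w → w ∈ Z) :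
    Set.MapsTo ψ Z Z := by
  intro v hv
  by_cases hfix : ψ v = v
  · rwa [hfix]
  · exact hO v hv _ (hψ v hfix)

theorem IsOneWay.apply_mem_iff [Finite V] (hO : IsOneWay Z O) (hψ : Follows O ψ) (v : V) :
    ψ v ∈ Z ↔ v ∈ Z := by
  rcases hO with hO | hO
  · have hmaps := hψ.mapsTo hO
    exact ⟨fun hv => by simpa using Equiv.Perm.perm_symm_mapsTo_of_mapsTo ψ hmaps hv, (hmaps ·)⟩
  · have hmaps : Set.MapsTo ψ Zᶜ Zᶜ := hψ.mapsTo hO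
    exact not_iff_not.1
      ⟨fun hv => by simpa using Equiv.Perm.perm_symm_mapsTo_of_mapsTo ψ hmaps hv, (hmaps ·)⟩

theorem follows_conj_iff [Finite V] (hO : IsOneWay Z O) (hO' : IsOneWay Z O')
    (hσ : ∀ v, σ v ∈ Z ↔ v ∈ Z)
    (h : ∀ v w, (v ∈ Z ↔ w ∈ Z) → (O' (σ v) = some (σ w) ↔ O v = some w)) :
    Follows O' (σ * ψ * σ⁻¹) ↔ Follows O ψ := by
  have hconj : Follows O' (σ * ψ * σ⁻¹) ↔ ∀ v, ψ v ≠ v → O' (σ v) = some (σ (ψ v)) := by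
    rw [Follows, ← σ.forall_congr_right]
    simp
  refine ⟨fun hψ v hv => ?_, fun hψ => hconj.2 fun v hv => ?_⟩
  · have hside : ψ v ∈ Z ↔ v ∈ Z := by
      simpa [hσ] using hO'.apply_mem_iff hψ (σ v)
    exact (h v (ψ v) hside.symm).1 (hconj.1 hψ v hv)
  · exact (h v (ψ v) (hO.apply_mem_iff hψ v).symm).2 (hψ v hv)

theorem apply_mem_iff_of_eqOn_compl (hσ : Set.EqOn σ id Zᶜ) (v : V) : σ v ∈ Z ↔ v ∈ Z := by
  refine ⟨fun hv => ?_, fun hv => ?_⟩ <;> by_contra hv'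
  · exact hv' (by simpa [hσ hv'] using hv)
  · exact hv' (by rwa [σ.injective (hσ hv')])

theorem transport_apply (hτ : Set.EqOn σ τ Z) (hσ : Set.EqOn σ id Zᶜ) (v : V) [Decidable (v ∈ Z)] :
    transport τ Z O (σ v) = if v ∈ Z then (O v).map τ else O v := by
  simp only [transport, apply_mem_iff_of_eqOn_compl hσ]
  split_ifs with hv
  · rw [hτ hv, Equiv.symm_apply_apply]
  · rw [hσ hv, id]

theorem isSome_transport (hτ : Set.EqOn σ τ Z) (hσ : Set.EqOn σ id Zᶜ) (v : V) :
    (transport τ Z O (σ v)).isSome = (O v).isSome := by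
  classical
  rw [transport_apply hτ hσ]
  split_ifs <;> simp

theorem transport_injective (hτ : Set.EqOn σ τ Z) (hσ : Set.EqOn σ id Zᶜ) :
    Function.Injective (transport τ Z) := by
  classical
  intro O O' h
  ext1 v
  have hv := congrFun h (σ v)
  rw [transport_apply hτ hσ, transport_apply hτ hσ] at hv
  split_ifs at hv
  · exact Option.map_injective τ.injective hv
  · exact hv

theorem transport_eq_some_iff (hτ : Set.EqOn σ τ Z) (hσ : Set.EqOn σ id Zᶜ) {v w : V}
    (hvw : v ∈ Z ↔ w ∈ Z) : transport τ Z O (σ v) = some (σ w) ↔ O v = some w := by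
  classical
  rw [transport_apply hτ hσ]
  split_ifs with hv
  · rw [hτ (hvw.1 hv), ← Option.map_some, (Option.map_injective τ.injective).eq_iff]
  · rw [hσ (mt hvw.2 hv), id]

theorem IsOneWay.transport (hO : IsOneWay Z O) (hτ : Set.EqOn σ τ Z) (hσ : Set.EqOn σ id Zᶜ) :
    IsOneWay Z (transport τ Z O) := by
  classical
  refine hO.imp (fun h v => ?_) (fun h v hv w hw => h v hv w ?_)
  · rw [← σ.apply_symm_apply v, apply_mem_iff_of_eqOn_compl hσ]
    intro hv w hw
    rw [transport_apply hτ hσ, if_pos hv, Option.map_eq_some_iff] at hw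
    obtain ⟨u, hu, rfl⟩ := hw
    rw [← hτ (h _ hv u hu), apply_mem_iff_of_eqOn_compl hσ]
    exact h _ hv u hu
  · rwa [_root_.transport, if_neg hv] at hw

theorem follows_transport_iff [Finite V] (hO : IsOneWay Z O) (hτ : Set.EqOn σ τ Z)
    (hσ : Set.EqOn σ id Zᶜ) : Follows (transport τ Z O) (σ * ψ * σ⁻¹) ↔ Follows O ψ :=
  follows_conj_iff hO (hO.transport hτ hσ) (apply_mem_iff_of_eqOn_compl hσ)
    fun _ _ => transport_eq_some_iff hτ hσ

end Arrows

section DirectedCycles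

variable {n : ℕ} {O O' : Fin n → Option (Fin n)}

theorem isDirectedCycle_iff {c : Equiv.Perm (Fin n)} :
    IsDirectedCycle O c ↔ c.IsCycle ∧ Follows O c := by
  simp only [IsDirectedCycle, Follows, Equiv.Perm.mem_support]

theorem isCycle_conj_iff {V : Type*} {σ c : Equiv.Perm V} : (σ * c * σ⁻¹).IsCycle ↔ c.IsCycle :=
  ⟨fun h => by simpa [mul_assoc] using h.conj (g := σ⁻¹), fun h => h.conj⟩

theorem numDirectedCycles_eq_of_follows_conj {σ : Equiv.Perm (Fin n)}
    (h : ∀ ψ, Follows O' (σ * ψ * σ⁻¹) ↔ Follows O ψ) (i : ℕ) :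
    numDirectedCycles O' i = numDirectedCycles O i := by
  refine (Finset.card_equiv (MulAut.conj σ).toEquiv fun c => ?_).symm
  simp [isDirectedCycle_iff, h, isCycle_conj_iff]

end DirectedCycles

/-- `H` arises from `G` by moving the bunch `S` from one end of a path to its other end `x`; here
`Q` is the union of `S` with the path, and `τ` reverses the path. Only the properties needed to
compare orientations of `H` and of `G` are recorded. -/
structure ShiftConfig {V : Type*} (G H : SimpleGraph V) (x : V) (S Q : Set V)
    (τ : Equiv.Perm V) : Prop where
  subset : S ⊆ Q
  mem : x ∈ Q
  notMem : x ∉ S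
  apply_of_mem : ∀ v ∈ S, τ v = v
  apply_of_notMem : ∀ v ∉ Q, τ v = v
  apply_ne : τ x ≠ x
  adj_of_notMem : ∀ a ∉ S, ∀ b ∉ S, H.Adj a b → G.Adj a b
  adj_map : ∀ a ∈ Q, ∀ b ∈ Q, H.Adj a b → G.Adj (τ a) (τ b)
  eq_of_adj_notMem : ∀ a ∈ Q, ∀ b ∉ Q, H.Adj a b → a = x
  eq_of_adj_mem : ∀ a ∈ S, ∀ b ∉ S, H.Adj a b → b = x

open Classical in
/-- The vertices whose arrows are relabelled when an orientation `O` of the shifted graph is turned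
into one of the original graph: the path has to be reversed exactly if the arrow at `x` points
into the bunch `S`. -/
noncomputable def shiftRegion {V : Type*} (x : V) (S Q : Set V) (O : V → Option V) : Set V :=
  if ∃ u ∈ S, O x = some u then Q else S

namespace ShiftConfig

variable {V : Type*} {G H : SimpleGraph V} {x : V} {S Q : Set V} {τ : Equiv.Perm V}
  {O : V → Option V}

theorem apply_notMem (h : ShiftConfig G H x S Q τ) : τ x ∉ S := fun hx =>
  h.apply_ne (τ.injective (h.apply_of_mem _ hx))

theorem exists_perm (h : ShiftConfig G H x S Q τ) (O : V → Option V) :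
    ∃ σ : Equiv.Perm V, Set.EqOn σ τ (shiftRegion x S Q O) ∧
      Set.EqOn σ id (shiftRegion x S Q O)ᶜ := by
  unfold shiftRegion
  split_ifs
  · exact ⟨τ, Set.eqOn_refl _ _, h.apply_of_notMem⟩
  · exact ⟨1, fun v hv => (h.apply_of_mem v hv).symm, fun _ _ => rfl⟩

theorem mem_of_mem_shiftRegion (h : ShiftConfig G H x S Q τ)
    (hO : ∀ v w, O v = some w → H.Adj v w) {v w : V} (hv : v ∈ shiftRegion x S Q O)
    (hw : O v = some w) : v ∈ Q ∧ w ∈ Q := by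
  unfold shiftRegion at hv
  split_ifs at hv with hx
  · refine ⟨hv, by_contra fun hwQ => hwQ ?_⟩
    obtain ⟨u, hu, hxu⟩ := hx
    obtain rfl := h.eq_of_adj_notMem v hv w hwQ (hO v w hw)
    obtain rfl : w = u := by simpa [hw] using hxu
    exact h.subset hu
  · refine ⟨h.subset hv, ?_⟩
    by_cases hwS : w ∈ S
    · exact h.subset hwS
    · exact h.eq_of_adj_mem v hv w hwS (hO v w hw) ▸ h.mem

theorem notMem_of_notMem_shiftRegion (h : ShiftConfig G H x S Q τ)
    (hO : ∀ v w, O v = some w → H.Adj v w) {v w : V} (hv : v ∉ shiftRegion x S Q O)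
    (hw : O v = some w) : v ∉ S ∧ w ∉ S := by
  unfold shiftRegion at hv
  split_ifs at hv with hx
  · have hvS : v ∉ S := mt (@h.subset v) hv
    exact ⟨hvS, fun hwS => hv (h.eq_of_adj_mem w hwS v hvS (hO v w hw).symm ▸ h.mem)⟩
  · refine ⟨hv, fun hwS => hx ⟨w, hwS, ?_⟩⟩
    rwa [← h.eq_of_adj_mem w hwS v hv (hO v w hw).symm]

theorem isOneWay_shiftRegion (h : ShiftConfig G H x S Q τ)
    (hO : ∀ v w, O v = some w → H.Adj v w) : IsOneWay (shiftRegion x S Q O) O := by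
  by_cases hx : ∃ u ∈ S, O x = some u
  · refine Or.inl fun v hv w hw => ?_
    have hwQ := (h.mem_of_mem_shiftRegion hO hv hw).2
    rwa [shiftRegion, if_pos hx]
  · refine Or.inr fun v hv w hw => ?_
    have hwS := (h.notMem_of_notMem_shiftRegion hO hv hw).2
    rwa [shiftRegion, if_neg hx]

theorem adj_of_transport_eq_some (h : ShiftConfig G H x S Q τ)
    (hO : ∀ v w, O v = some w → H.Adj v w) {v w : V}
    (hvw : transport τ (shiftRegion x S Q O) O v = some w) : G.Adj v w := by
  unfold transport at hvw
  obtain ⟨σ, hτ, hσ⟩ := h.exists_perm O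
  split_ifs at hvw with hv
  · obtain ⟨u, hu, rfl⟩ := Option.map_eq_some_iff.1 hvw
    have hv' : τ.symm v ∈ shiftRegion x S Q O := by
      rw [← σ.apply_symm_apply v, apply_mem_iff_of_eqOn_compl hσ] at hv
      rwa [← σ.apply_symm_apply v, hτ hv, Equiv.symm_apply_apply]
    have hQ := h.mem_of_mem_shiftRegion hO hv' hu
    simpa using h.adj_map _ hQ.1 u hQ.2 (hO _ u hu)
  · have hS := h.notMem_of_notMem_shiftRegion hO hv hvw
    exact h.adj_of_notMem v hS.1 w hS.2 (hO v w hvw)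

theorem transport_apply_mem_iff (h : ShiftConfig G H x S Q τ)
    (hO : ∀ v w, O v = some w → H.Adj v w) :
    (∃ u ∈ S, transport τ (shiftRegion x S Q O) O (τ x) = some u) ↔ ∃ u ∈ S, O x = some u := by
  by_cases hx : ∃ u ∈ S, O x = some u
  · refine iff_of_true ?_ hx
    obtain ⟨u, hu, hxu⟩ := hx
    have hτx : transport τ Q O (τ x) = (O x).map τ := by
      classical
      rw [transport_apply (Set.eqOn_refl τ Q) h.apply_of_notMem, if_pos h.mem]
    rw [shiftRegion, if_pos ⟨u, hu, hxu⟩, hτx, hxu]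
    exact ⟨u, hu, congrArg some (h.apply_of_mem u hu)⟩
  · refine iff_of_false ?_ hx
    rintro ⟨u, hu, hxu⟩
    rw [shiftRegion, if_neg hx, transport, if_neg h.apply_notMem] at hxu
    exact h.apply_ne (h.eq_of_adj_mem u hu _ h.apply_notMem (hO _ u hxu).symm)

theorem injOn_transport (h : ShiftConfig G H x S Q τ) :
    Set.InjOn (fun O => transport τ (shiftRegion x S Q O) O)
      {O | ∀ v w, O v = some w → H.Adj v w} := by
  intro O hO O' hO' heq
  dsimp only at heq
  have hregion : shiftRegion x S Q O = shiftRegion x S Q O' := by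
    have hx : (∃ u ∈ S, O x = some u) ↔ ∃ u ∈ S, O' x = some u := by
      rw [← h.transport_apply_mem_iff hO, heq, h.transport_apply_mem_iff hO']
    classical
    exact if_congr hx rfl rfl
  obtain ⟨σ, hτ, hσ⟩ := h.exists_perm O
  exact transport_injective hτ hσ (by rwa [← hregion] at heq)

theorem transport_mem_orientations {n : ℕ} {G H : SimpleGraph (Fin n)} {x : Fin n}
    {S Q : Set (Fin n)} {τ : Equiv.Perm (Fin n)} (h : ShiftConfig G H x S Q τ) {r : ℕ}
    {mu : n.Partition} {O : Fin n → Option (Fin n)} (hO : O ∈ orientations H r mu) :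
    transport τ (shiftRegion x S Q O) O ∈ orientations G r mu := by
  simp only [orientations, Finset.mem_filter, Finset.mem_univ, true_and] at hO ⊢
  obtain ⟨⟨B, rfl, hB, hadj⟩, htype⟩ := hO
  obtain ⟨σ, hτ, hσ⟩ := h.exists_perm O
  refine ⟨⟨B.map σ.toEmbedding, B.card_map _, fun v => ?_,
    fun v w => h.adj_of_transport_eq_some hadj⟩, fun i hi => ?_⟩
  · obtain ⟨u, rfl⟩ := σ.surjective v
    rw [isSome_transport hτ hσ, hB]
    simp
  · rw [htype i hi]
    exact (numDirectedCycles_eq_of_follows_conj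
      (fun ψ => follows_transport_iff (h.isOneWay_shiftRegion hadj) hτ hσ) i).symm

theorem numOrientations_le {n : ℕ} {G H : SimpleGraph (Fin n)} {x : Fin n} {S Q : Set (Fin n)}
    {τ : Equiv.Perm (Fin n)} (h : ShiftConfig G H x S Q τ) (r : ℕ) (mu : n.Partition) :
    numOrientations H r mu ≤ numOrientations G r mu := by
  refine Finset.card_le_card_of_injOn _ (fun O => h.transport_mem_orientations)
    (h.injOn_transport.mono fun O hO => ?_)
  simp only [orientations, Finset.coe_filter, Finset.mem_univ, true_and] at hO
  obtain ⟨⟨B, -, -, hadj⟩, -⟩ := hO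
  exact hadj

end ShiftConfig

section Path

variable {V : Type*} {G : SimpleGraph V} {x y : V} {p : G.Walk x y}

theorem exists_perm_reverse (hp : p.IsPath) : ∃ τ : Equiv.Perm V,
    (∀ i ≤ p.length, τ (p.getVert i) = p.getVert (p.length - i)) ∧ ∀ v ∉ p.support, τ v = v := by
  classical
  let e := List.Nodup.getEquiv p.support hp.support_nodup
  have he : ∀ (i : ℕ) (hi : i < p.support.length), (e ⟨i, hi⟩ : V) = p.getVert i := fun i hi =>
    (p.getVert_eq_support_getElem (by grind [p.length_support])).symm
  refine ⟨Equiv.Perm.extendDomain Fin.revPerm e, fun i hi => ?_, fun v hv =>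
    Equiv.Perm.extendDomain_apply_not_subtype _ _ hv⟩
  have hi' : i < p.support.length := by grind [p.length_support]
  rw [← he i hi', Equiv.Perm.extendDomain_apply_image, Fin.revPerm_apply, Fin.rev, he]
  congr 1
  grind [p.length_support]

theorem adj_map_of_mem_edges {τ : V → V}
    (hτ : ∀ i ≤ p.length, τ (p.getVert i) = p.getVert (p.length - i)) {a b : V}
    (hab : s(a, b) ∈ p.edges) : G.Adj (τ a) (τ b) := by
  obtain ⟨i, hi, hi'⟩ := p.mk_mem_edges_iff_exists.1 hab
  have hadj : G.Adj (τ (p.getVert i)) (τ (p.getVert (i + 1))) := by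
    rw [hτ i hi.le, hτ (i + 1) hi, show p.length - i = p.length - (i + 1) + 1 by omega]
    exact (p.adj_getVert_succ (by omega)).symm
  rcases Sym2.eq_iff.1 hi' with ⟨rfl, rfl⟩ | ⟨rfl, rfl⟩
  · exact hadj
  · exact hadj.symm

/-- The graph `G` without the edges of the walk `p`. -/
def offWalk (p : G.Walk x y) : SimpleGraph V :=
  G.deleteEdges p.edgeSet

theorem offWalk_adj {a b : V} : (offWalk p).Adj a b ↔ G.Adj a b ∧ s(a, b) ∉ p.edges := by
  simp [offWalk]

theorem offWalk_le : offWalk p ≤ G :=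
  G.deleteEdges_le p.edgeSet

theorem not_offWalk_adj_of_degree_eq_two [Fintype V] [DecidableRel G.Adj] (hp : p.IsPath) {v : V}
    (hv : v ∈ p.support) (hvx : v ≠ x) (hvy : v ≠ y) (hdeg : G.degree v = 2) (u : V) :
    ¬(offWalk p).Adj v u := by
  obtain ⟨i, rfl, hi⟩ := p.mem_support_iff_exists_getVert.1 hv
  have hi0 : i ≠ 0 := by
    rintro rfl
    exact hvx p.getVert_zero
  have hil : i < p.length := by
    refine hi.lt_of_ne ?_
    rintro rfl
    exact hvy p.getVert_length
  have hnbr : p.toSubgraph.neighborSet (p.getVert i) = G.neighborSet (p.getVert i) := by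
    refine Set.eq_of_subset_of_ncard_le (p.toSubgraph.neighborSet_subset _) ?_ (Set.toFinite _)
    rw [hp.ncard_neighborSet_toSubgraph_internal_eq_two hi0 hil, ← hdeg,
      ← SimpleGraph.card_neighborFinset_eq_degree, ← Set.ncard_coe_finset,
      SimpleGraph.coe_neighborFinset]
  rw [offWalk_adj, ← SimpleGraph.Walk.adj_toSubgraph_iff_mem_edges]
  exact fun h => h.2 (hnbr.symm.subset h.1)

theorem eq_of_offWalk_reachable
    (hint : ∀ v ∈ p.support, v ≠ x → v ≠ y → ∀ u, ¬(offWalk p).Adj v u) {v : V}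
    (hv : v ∈ p.support) (h : (offWalk p).Reachable y v) : v = x ∨ v = y := by
  by_contra! hne
  obtain ⟨q⟩ := h
  exact hint v hv hne.1 hne.2 _ (q.adj_penultimate (SimpleGraph.Walk.not_nil_of_ne hne.2.symm)).symm

theorem not_offWalk_reachable (hxy : x ≠ y) (hp : p.IsPath)
    (hint : ∀ v ∈ p.support, v ≠ x → v ≠ y → ∀ u, ¬(offWalk p).Adj v u)
    (hcyc : ∀ (z : V) (c : G.Walk z z), c.IsCycle → ¬(x ∈ c.support ∧ y ∈ c.support)) :
    ¬(offWalk p).Reachable y x := by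
  classical
  intro h
  obtain ⟨q, hq⟩ := h.exists_isPath
  have htails : p.support.tail.Disjoint q.support.tail := by
    intro v hvp hvq
    rcases eq_of_offWalk_reachable hint (List.mem_of_mem_tail hvp)
      (q.takeUntil v (List.mem_of_mem_tail hvq)).reachable with rfl | rfl
    · exact (List.nodup_cons.1 (p.cons_tail_support ▸ hp.support_nodup)).1 hvp
    · exact (List.nodup_cons.1 (q.cons_tail_support ▸ hq.support_nodup)).1 hvq
  have hlen : 1 < p.length ∨ 1 < q.length := by
    by_contra! hle
    have hpx : p.penultimate = x := by
      rw [SimpleGraph.Walk.penultimate, Nat.sub_eq_zero_of_le hle.1, p.getVert_zero]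
    have hqx : q.penultimate = y := by
      rw [SimpleGraph.Walk.penultimate, Nat.sub_eq_zero_of_le hle.2, q.getVert_zero]
    have hpe := p.mk_penultimate_end_mem_edges (SimpleGraph.Walk.not_nil_of_ne hxy)
    have hqe := q.adj_penultimate (SimpleGraph.Walk.not_nil_of_ne hxy.symm)
    rw [hpx, Sym2.eq_swap] at hpe
    rw [hqx] at hqe
    exact (offWalk_adj.1 hqe).2 hpe
  have hcycle := hp.isCycle_append (hq.mapLe offWalk_le) (by simpa using htails)
    (by simpa using hlen)
  exact hcyc x _ hcycle (by simp)

theorem mem_edges_or_of_moveNeighbors_adj (hxy : x ≠ y) (hp : p.IsPath) {a b : V}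
    (h : (moveNeighbors G x y p.penultimate).Adj a b) :
    s(a, b) ∈ p.edges ∨ ((offWalk p).Adj a b ∧ a ≠ y ∧ b ≠ y) ∨
      (a = x ∧ (offWalk p).Adj y b) ∨ (b = x ∧ (offWalk p).Adj y a) := by
  have hkept : s(y, p.penultimate) ∈ p.edges := by
    rw [Sym2.eq_swap]
    exact p.mk_penultimate_end_mem_edges (SimpleGraph.Walk.not_nil_of_ne hxy)
  rw [moveNeighbors, SimpleGraph.fromEdgeSet_adj] at h
  obtain ⟨⟨hab, hnotMoved⟩ | ⟨u, hyu, hu, he⟩, -⟩ := h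
  · by_cases hpath : s(a, b) ∈ p.edges
    · exact Or.inl hpath
    · refine Or.inr (Or.inl ⟨offWalk_adj.2 ⟨hab, hpath⟩, ?_, ?_⟩) <;> rintro rfl
      · exact hnotMoved ⟨b, hab, fun hb => hpath (hb ▸ hkept), rfl⟩
      · exact hnotMoved ⟨a, hab.symm, fun ha => hpath (ha ▸ Sym2.eq_swap ▸ hkept), Sym2.eq_swap⟩
  · have hoff : (offWalk p).Adj y u := offWalk_adj.2 ⟨hyu, mt hp.eq_penultimate_of_mem_edges hu⟩
    rcases Sym2.eq_iff.1 he with ⟨rfl, rfl⟩ | ⟨rfl, rfl⟩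
    · exact Or.inr (Or.inr (Or.inl ⟨rfl, hoff⟩))
    · exact Or.inr (Or.inr (Or.inr ⟨rfl, hoff⟩))

/-- The vertices other than `y` in the component of `y` once the edges of the walk `p` to `y` are
removed. -/
def bunch (p : G.Walk x y) : Set V :=
  {v | (offWalk p).Reachable y v ∧ v ≠ y}

theorem mem_bunch_of_adj {a b : V} (ha : a ∈ bunch p) (hab : (offWalk p).Adj a b) (hb : b ≠ y) :
    b ∈ bunch p :=
  ⟨ha.1.trans hab.reachable, hb⟩

theorem mem_bunch_of_adj_end {b : V} (hb : (offWalk p).Adj y b) : b ∈ bunch p :=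
  ⟨hb.reachable, hb.ne'⟩

theorem notMem_bunch_of_mem_support (hx : ¬(offWalk p).Reachable y x)
    (hint : ∀ v ∈ p.support, v ≠ x → v ≠ y → ∀ u, ¬(offWalk p).Adj v u) {v : V}
    (hv : v ∈ p.support) : v ∉ bunch p := by
  rintro ⟨hreach, hvy⟩
  rcases eq_of_offWalk_reachable hint hv hreach with rfl | rfl
  · exact hx hreach
  · exact hvy rfl

theorem eq_or_mem_bunch_of_offWalk_adj
    (hint : ∀ v ∈ p.support, v ≠ x → v ≠ y → ∀ u, ¬(offWalk p).Adj v u) {a b : V}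
    (ha : a ∈ p.support ∨ a ∈ bunch p) (hab : (offWalk p).Adj a b) (hay : a ≠ y) (hby : b ≠ y) :
    a = x ∨ a ∈ bunch p ∧ b ∈ bunch p := by
  rcases ha with ha | ha
  · exact Or.inl (by_contra fun hax => hint a ha hax hay b hab)
  · exact Or.inr ⟨ha, mem_bunch_of_adj ha hab hby⟩

theorem adj_map_of_moveNeighbors_adj (hxy : x ≠ y) (hp : p.IsPath)
    (hint : ∀ v ∈ p.support, v ≠ x → v ≠ y → ∀ u, ¬(offWalk p).Adj v u)
    (hx : ¬(offWalk p).Reachable y x) {τ : V → V}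
    (hτ : ∀ i ≤ p.length, τ (p.getVert i) = p.getVert (p.length - i))
    (hfix : ∀ v ∈ bunch p, τ v = v) {a b : V} (ha : a ∈ p.support ∨ a ∈ bunch p)
    (hb : b ∈ p.support ∨ b ∈ bunch p) (hab : (moveNeighbors G x y p.penultimate).Adj a b) :
    G.Adj (τ a) (τ b) := by
  have hτx : τ x = y := by simpa using hτ 0 (Nat.zero_le _)
  have hxS : x ∉ bunch p := fun h => hx h.1
  obtain hedge | ⟨hoff, hay, hby⟩ | ⟨rfl, hoff⟩ | ⟨rfl, hoff⟩ :=
    mem_edges_or_of_moveNeighbors_adj hxy hp hab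
  · exact adj_map_of_mem_edges hτ hedge
  · rcases eq_or_mem_bunch_of_offWalk_adj hint ha hoff hay hby with rfl | ⟨haS, hbS⟩
    · rcases eq_or_mem_bunch_of_offWalk_adj hint hb hoff.symm hby hay with rfl | ⟨-, hS⟩
      · exact absurd rfl hoff.ne
      · exact absurd hS hxS
    · rw [hfix a haS, hfix b hbS]
      exact offWalk_le hoff
  · rw [hτx, hfix b (mem_bunch_of_adj_end hoff)]
    exact offWalk_le hoff
  · rw [hτx, hfix a (mem_bunch_of_adj_end hoff)]
    exact (offWalk_le hoff).symm

theorem exists_shiftConfig_moveNeighbors (hxy : x ≠ y) (hp : p.IsPath)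
    (hint : ∀ v ∈ p.support, v ≠ x → v ≠ y → ∀ u, ¬(offWalk p).Adj v u)
    (hx : ¬(offWalk p).Reachable y x) :
    ∃ τ, ShiftConfig G (moveNeighbors G x y p.penultimate) x (bunch p)
      {v | v ∈ p.support ∨ v ∈ bunch p} τ := by
  obtain ⟨τ, hτ, hτfix⟩ := exists_perm_reverse hp
  have hS {v : V} : v ∈ p.support → v ∉ bunch p := notMem_bunch_of_mem_support hx hint
  have hτx : τ x = y := by simpa using hτ 0 (Nat.zero_le _)
  have hτS : ∀ v ∈ bunch p, τ v = v := fun v hv => hτfix v fun hvp => hS hvp hv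
  refine ⟨τ, {
    subset := fun _ => Or.inr
    mem := Or.inl p.start_mem_support
    notMem := hS p.start_mem_support
    apply_of_mem := hτS
    apply_of_notMem := fun v hv => hτfix v fun hvp => hv (Or.inl hvp)
    apply_ne := hτx ▸ hxy.symm
    adj_of_notMem := fun a ha b hb hab => ?_
    adj_map := fun a ha b hb =>
      adj_map_of_moveNeighbors_adj hxy hp hint hx hτ hτS ha hb
    eq_of_adj_notMem := fun a ha b hb hab => ?_
    eq_of_adj_mem := fun a ha b hb hab => ?_ }⟩ <;>
  obtain hedge | ⟨hoff, hay, hby⟩ | ⟨rfl, hoff⟩ | ⟨rfl, hoff⟩ :=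
    mem_edges_or_of_moveNeighbors_adj hxy hp hab
  · exact p.adj_of_mem_edges hedge
  · exact offWalk_le hoff
  · exact absurd (mem_bunch_of_adj_end hoff) hb
  · exact absurd (mem_bunch_of_adj_end hoff) ha
  · exact absurd (Or.inl (p.snd_mem_support_of_mem_edges hedge)) hb
  · exact (eq_or_mem_bunch_of_offWalk_adj hint ha hoff hay hby).resolve_right
      fun h => hb (Or.inr h.2)
  · rfl
  · exact absurd (Or.inl p.start_mem_support) hb
  · exact absurd ha (hS (p.fst_mem_support_of_mem_edges hedge))
  · exact absurd (mem_bunch_of_adj ha hoff hby) hb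
  · exact absurd ha (hS p.start_mem_support)
  · rfl

end Path

theorem IsGGS.exists_shiftConfig {V : Type*} [Fintype V] {G₁ G₂ : SimpleGraph V}
    [DecidableRel G₁.Adj] (h : IsGGS G₁ G₂) : ∃ x S Q τ, ShiftConfig G₁ G₂ x S Q τ := by
  obtain ⟨x, y, p, hxy, hp, hdeg, hcyc, rfl⟩ := h
  have hint : ∀ v ∈ p.support, v ≠ x → v ≠ y → ∀ u, ¬(offWalk p).Adj v u :=
    fun v hv hvx hvy => not_offWalk_adj_of_degree_eq_two hp hv hvx hvy (hdeg v hv hvx hvy)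
  obtain ⟨τ, hτ⟩ :=
    exists_shiftConfig_moveNeighbors hxy hp hint (not_offWalk_reachable hxy hp hint hcyc)
  exact ⟨x, _, _, τ, hτ⟩

theorem IsGGS.numOrientations_le {n : ℕ} {G₁ G₂ : SimpleGraph (Fin n)} [DecidableRel G₁.Adj]
    (h : IsGGS G₁ G₂) (r : ℕ) (mu : n.Partition) :
    numOrientations G₂ r mu ≤ numOrientations G₁ r mu := by
  obtain ⟨x, S, Q, τ, hconfig⟩ := h.exists_shiftConfig
  exact hconfig.numOrientations_le r mu

section Representation

open ComplexOrder

variable {H W : Type*} [Group H]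

theorem sum_trace_mul_inv_nonneg_of_unitary [NormedAddCommGroup W] [InnerProductSpace ℂ W]
    [FiniteDimensional ℂ W] (ρ : Representation ℂ H W)
    (hρ : ∀ g u v, inner ℂ (ρ g u) (ρ g v) = inner ℂ u v) (E : Finset H) :
    0 ≤ ∑ g ∈ E, ∑ h ∈ E, LinearMap.trace ℂ W (ρ (g * h⁻¹)) := by
  have hadj : ∀ h, LinearMap.adjoint (ρ h) = ρ h⁻¹ := by
    intro h
    rw [eq_comm, LinearMap.eq_adjoint_iff]
    intro u v
    rw [← hρ h, ρ.self_inv_apply]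
  -- The double sum is the trace of `T T*` for `T = ∑ g ∈ E, ρ g`.
  have hpos := (LinearMap.isPositive_self_comp_adjoint (∑ g ∈ E, ρ g)).trace_nonneg
  simpa only [map_sum, hadj, ← Module.End.mul_eq_comp, Finset.sum_mul_sum, map_mul] using hpos

variable [AddCommGroup W] [Module ℂ W] [FiniteDimensional ℂ W]

/-- The orbit map `w ↦ (ρ g w)_g`, in coordinates. The inner product it induces on `W` is the
average over the group that makes `ρ` unitary. -/
noncomputable def orbitMap (ρ : Representation ℂ H W) :
    W →ₗ[ℂ] EuclideanSpace ℂ (H × Fin (Module.finrank ℂ W)) :=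
  (WithLp.linearEquiv 2 ℂ _).symm.toLinearMap ∘ₗ
    LinearMap.pi fun i => LinearMap.proj i.2 ∘ₗ
      (Module.finBasis ℂ W).equivFun.toLinearMap ∘ₗ ρ i.1

theorem orbitMap_injective (ρ : Representation ℂ H W) : Function.Injective (orbitMap ρ) := by
  intro u v huv
  refine (Module.finBasis ℂ W).equivFun.injective (funext fun i => ?_)
  simpa [orbitMap] using congrArg (fun w => w (1, i)) huv

theorem inner_orbitMap [Fintype H] (ρ : Representation ℂ H W) (h : H) (u v : W) :
    inner ℂ (orbitMap ρ (ρ h u)) (orbitMap ρ (ρ h v)) = inner ℂ (orbitMap ρ u) (orbitMap ρ v) := by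
  simp only [PiLp.inner_apply]
  refine Fintype.sum_equiv ((Equiv.mulRight h).prodCongr (Equiv.refl _)) _ _ fun i => ?_
  simp [orbitMap]

theorem sum_trace_mul_inv_nonneg [Finite H] (ρ : Representation ℂ H W) (E : Finset H) :
    0 ≤ ∑ g ∈ E, ∑ h ∈ E, LinearMap.trace ℂ W (ρ (g * h⁻¹)) := by
  have := Fintype.ofFinite H
  let := NormedAddCommGroup.induced W _ (orbitMap ρ) (orbitMap_injective ρ)
  let := InnerProductSpace.induced (orbitMap ρ)
  exact sum_trace_mul_inv_nonneg_of_unitary ρ (inner_orbitMap ρ) E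

end Representation

section CycleFactors

variable {V : Type*} [Fintype V] [DecidableEq V] {π ψ φ : Equiv.Perm V}

theorem exists_cycleFactorsFinset_eq {T : Finset (Equiv.Perm V)} (hcycle : ∀ c ∈ T, c.IsCycle)
    (hdisj : (T : Set (Equiv.Perm V)).Pairwise Equiv.Perm.Disjoint) :
    ∃ ψ : Equiv.Perm V, ψ.cycleFactorsFinset = T :=
  ⟨_, Equiv.Perm.cycleFactorsFinset_eq_finset.2 ⟨hcycle, hdisj, rfl⟩⟩

theorem exists_cycleFactorsFinset_eq_of_subset {T : Finset (Equiv.Perm V)}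
    (hT : T ⊆ π.cycleFactorsFinset) : ∃ ψ : Equiv.Perm V, ψ.cycleFactorsFinset = T :=
  exists_cycleFactorsFinset_eq
    (fun _ hc => (Equiv.Perm.mem_cycleFactorsFinset_iff.1 (hT hc)).1)
    (π.cycleFactorsFinset_pairwise_disjoint.mono (Finset.coe_subset.2 hT))

theorem disjoint_of_disjoint_cycleFactorsFinset (hψ : ψ.cycleFactorsFinset ⊆ π.cycleFactorsFinset)
    (hφ : φ.cycleFactorsFinset ⊆ π.cycleFactorsFinset)
    (h : Disjoint ψ.cycleFactorsFinset φ.cycleFactorsFinset) : ψ.Disjoint φ := by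
  rw [Equiv.Perm.disjoint_iff_disjoint_support, Finset.disjoint_left]
  intro v hv hv'
  obtain ⟨c, hc, hvc⟩ := Equiv.Perm.mem_support_iff_mem_support_of_mem_cycleFactorsFinset.1 hv
  obtain ⟨d, hd, hvd⟩ := Equiv.Perm.mem_support_iff_mem_support_of_mem_cycleFactorsFinset.1 hv'
  have hcd : c = d := (Equiv.Perm.cycle_is_cycleOf hvc (hψ hc)).trans
    (Equiv.Perm.cycle_is_cycleOf hvd (hφ hd)).symm
  exact Finset.disjoint_left.1 h hc (hcd ▸ hd)

theorem cycleType_mul_inv_eq (hψ : ψ.cycleFactorsFinset ⊆ π.cycleFactorsFinset)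
    (hφ : φ.cycleFactorsFinset ⊆ π.cycleFactorsFinset) :
    (ψ * φ⁻¹).cycleType =
      (symmDiff ψ.cycleFactorsFinset φ.cycleFactorsFinset).val.map fun c => c.support.card := by
  set S := ψ.cycleFactorsFinset
  set T := φ.cycleFactorsFinset
  obtain ⟨α, hα⟩ :=
    exists_cycleFactorsFinset_eq_of_subset (Finset.sdiff_subset.trans hψ : S \ T ⊆ _)
  obtain ⟨β, hβ⟩ :=
    exists_cycleFactorsFinset_eq_of_subset (Finset.sdiff_subset.trans hφ : T \ S ⊆ _)
  obtain ⟨γ, hγ⟩ :=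
    exists_cycleFactorsFinset_eq_of_subset (Finset.inter_subset_left.trans hψ : S ∩ T ⊆ _)
  have hαπ : α.cycleFactorsFinset ⊆ π.cycleFactorsFinset := hα ▸ Finset.sdiff_subset.trans hψ
  have hβπ : β.cycleFactorsFinset ⊆ π.cycleFactorsFinset := hβ ▸ Finset.sdiff_subset.trans hφ
  have hγπ : γ.cycleFactorsFinset ⊆ π.cycleFactorsFinset := hγ ▸ Finset.inter_subset_left.trans hψ
  have hαγ : α.Disjoint γ := disjoint_of_disjoint_cycleFactorsFinset hαπ hγπ <| by
    rw [hα, hγ]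
    exact Finset.disjoint_sdiff_inter S T
  have hβγ : β.Disjoint γ := disjoint_of_disjoint_cycleFactorsFinset hβπ hγπ <| by
    rw [hβ, hγ, Finset.inter_comm]
    exact Finset.disjoint_sdiff_inter T S
  have hαβ : α.Disjoint β := disjoint_of_disjoint_cycleFactorsFinset hαπ hβπ <| by
    rw [hα, hβ]
    exact disjoint_sdiff_sdiff
  have hψ_eq : ψ = α * γ := Equiv.Perm.cycleFactorsFinset_injective <| by
    rw [hαγ.cycleFactorsFinset_mul_eq_union, hα, hγ, Finset.sdiff_union_inter]
  have hφ_eq : φ = β * γ := Equiv.Perm.cycleFactorsFinset_injective <| by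
    rw [hβγ.cycleFactorsFinset_mul_eq_union, hβ, hγ, Finset.inter_comm, Finset.sdiff_union_inter]
  have hquot : ψ * φ⁻¹ = α * β⁻¹ := by
    rw [hψ_eq, hφ_eq]
    group
  rw [hquot, hαβ.inv_right.cycleType_mul, Equiv.Perm.cycleType_inv, ← hαβ.cycleType_mul,
    Equiv.Perm.cycleType_def, hαβ.cycleFactorsFinset_mul_eq_union, hα, hβ]
  rfl

theorem sum_powerset_map_eq {ι κ M : Type*} [AddCommMonoid M] (T : Finset ι)
    (ℓ : ι → κ) (F : Multiset κ → M) :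
    ∑ S ∈ T.powerset, F (S.val.map ℓ) = ((T.val.map ℓ).powerset.map F).sum := by
  classical
  induction T using Finset.induction_on generalizing F with
  | empty => simp
  | insert a T ha ih =>
    have hinsert : ∀ S ∈ T.powerset,
        F ((insert a S).val.map ℓ) = F (ℓ a ::ₘ S.val.map ℓ) := by
      intro S hS
      rw [Finset.insert_val_of_notMem fun haS => ha (Finset.mem_powerset.1 hS haS),
        Multiset.map_cons]
    rw [Finset.sum_powerset_insert ha, Finset.sum_congr rfl hinsert, ih, ih fun m => F (ℓ a ::ₘ m),
      Finset.insert_val_of_notMem ha, Multiset.map_cons, Multiset.powerset_cons, Multiset.map_add,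
      Multiset.sum_add, Multiset.map_map]
    rfl

theorem sum_powerset_symmDiff {ι M : Type*} [DecidableEq ι] [AddCommMonoid M] {A T : Finset ι}
    (hA : A ⊆ T) (K : Finset ι → M) :
    ∑ S ∈ T.powerset, K (symmDiff S A) = ∑ S ∈ T.powerset, K S := by
  have hmem : ∀ S ∈ T.powerset, symmDiff S A ∈ T.powerset := fun S hS =>
    Finset.mem_powerset.2 (symmDiff_le_sup.trans (sup_le (Finset.mem_powerset.1 hS) hA))
  exact Finset.sum_bij' (fun S _ => symmDiff S A) (fun S _ => symmDiff S A) hmem hmem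
    (fun S _ => symmDiff_symmDiff_cancel_right A S) (fun S _ => symmDiff_symmDiff_cancel_right A S)
    fun _ _ => rfl

theorem sum_cycleFactorsFinset_eq_sum_powerset {M : Type*} [AddCommMonoid M]
    (K : Finset (Equiv.Perm V) → M) (π : Equiv.Perm V) :
    ∑ ψ : Equiv.Perm V with ψ.cycleFactorsFinset ⊆ π.cycleFactorsFinset, K ψ.cycleFactorsFinset =
      ∑ S ∈ π.cycleFactorsFinset.powerset, K S := by
  refine Finset.sum_bij (fun ψ _ => ψ.cycleFactorsFinset) (by simp)
    (fun _ _ _ _ h => Equiv.Perm.cycleFactorsFinset_injective h) (fun S hS => ?_) fun _ _ => rfl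
  obtain ⟨ψ, rfl⟩ := exists_cycleFactorsFinset_eq_of_subset (Finset.mem_powerset.1 hS)
  exact ⟨ψ, by simpa using hS, rfl⟩

theorem sum_cycleType_mul_inv {M : Type*} [AddCommMonoid M] (F : Multiset ℕ → M)
    (hφ : φ.cycleFactorsFinset ⊆ π.cycleFactorsFinset) :
    ∑ ψ : Equiv.Perm V with ψ.cycleFactorsFinset ⊆ π.cycleFactorsFinset, F (ψ * φ⁻¹).cycleType =
      (π.cycleType.powerset.map F).sum := by
  let K (S : Finset (Equiv.Perm V)) : M := F (S.val.map fun c => c.support.card)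
  calc
    _ = ∑ ψ : Equiv.Perm V with ψ.cycleFactorsFinset ⊆ π.cycleFactorsFinset,
        K (symmDiff ψ.cycleFactorsFinset φ.cycleFactorsFinset) := by
      refine Finset.sum_congr rfl fun ψ hψ => ?_
      rw [cycleType_mul_inv_eq (Finset.mem_filter.1 hψ).2 hφ]
    _ = ∑ S ∈ π.cycleFactorsFinset.powerset, K S := by
      rw [sum_cycleFactorsFinset_eq_sum_powerset (fun S => K (symmDiff S φ.cycleFactorsFinset)),
        sum_powerset_symmDiff hφ]
    _ = _ := by
      rw [sum_powerset_map_eq, π.cycleType_def]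
      rfl

theorem sum_cycleType {M : Type*} [AddCommMonoid M] (F : Multiset ℕ → M) (π : Equiv.Perm V) :
    ∑ ψ : Equiv.Perm V with ψ.cycleFactorsFinset ⊆ π.cycleFactorsFinset, F ψ.cycleType =
      (π.cycleType.powerset.map F).sum := by
  simpa using sum_cycleType_mul_inv F (π := π) (φ := 1) (by simp)

open ComplexOrder in
theorem sum_powerset_cycleType_nonneg {F : Multiset ℕ → ℂ}
    (hF : ∀ E : Finset (Equiv.Perm V), 0 ≤ ∑ g ∈ E, ∑ h ∈ E, F (g * h⁻¹).cycleType)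
    (π : Equiv.Perm V) : 0 ≤ (π.cycleType.powerset.map F).sum := by
  set E := Finset.univ.filter fun ψ : Equiv.Perm V =>
    ψ.cycleFactorsFinset ⊆ π.cycleFactorsFinset
  have h := hF E
  rw [Finset.sum_comm, Finset.sum_congr rfl fun φ hφ =>
    sum_cycleType_mul_inv F (Finset.mem_filter.1 hφ).2, Finset.sum_const,
    ← Nat.cast_smul_eq_nsmul ℝ] at h
  refine (smul_nonneg_iff_nonneg_of_pos_left (Nat.cast_pos.2 (Finset.card_pos.2 ⟨1, ?_⟩))).1 h
  simp

end CycleFactors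

section DirectedCycleFactors

variable {n : ℕ} {O : Fin n → Option (Fin n)} {π ψ : Equiv.Perm (Fin n)}

theorem IsDirectedCycle.eq_or_disjoint {c d : Equiv.Perm (Fin n)} (hc : IsDirectedCycle O c)
    (hd : IsDirectedCycle O d) : c = d ∨ c.Disjoint d := by
  rw [Equiv.Perm.disjoint_iff_disjoint_support, or_iff_not_imp_right, Finset.not_disjoint_iff]
  rintro ⟨v, hvc, hvd⟩
  have heq : ∀ u ∈ c.support ∩ d.support, c u = d u := fun u hu =>
    Option.some_injective _ <| (hc.2 u (Finset.mem_inter.1 hu).1).symm.trans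
      (hd.2 u (Finset.mem_inter.1 hu).2)
  exact hc.1.eq_on_support_inter_nonempty_congr hd.1 heq (heq v (Finset.mem_inter.2 ⟨hvc, hvd⟩)) hvc

theorem exists_mem_cycleFactorsFinset_iff_isDirectedCycle (O : Fin n → Option (Fin n)) :
    ∃ π : Equiv.Perm (Fin n), ∀ c, c ∈ π.cycleFactorsFinset ↔ IsDirectedCycle O c := by
  classical
  have hcycle : ∀ c ∈ Finset.univ.filter (IsDirectedCycle O), c.IsCycle := fun c hc =>
    (Finset.mem_filter.1 hc).2.1
  obtain ⟨π, hπ⟩ := exists_cycleFactorsFinset_eq hcycle fun c hc d hd hcd =>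
    ((Finset.mem_filter.1 hc).2.eq_or_disjoint (Finset.mem_filter.1 hd).2).resolve_left hcd
  exact ⟨π, by simp [hπ]⟩

theorem follows_iff_cycleFactorsFinset_subset
    (hπ : ∀ c, c ∈ π.cycleFactorsFinset ↔ IsDirectedCycle O c) :
    Follows O ψ ↔ ψ.cycleFactorsFinset ⊆ π.cycleFactorsFinset := by
  refine ⟨fun hψ c hc => (hπ c).2 ?_, fun hψ v hv => ?_⟩
  · obtain ⟨hcycle, hcψ⟩ := Equiv.Perm.mem_cycleFactorsFinset_iff.1 hc
    refine ⟨hcycle, fun v hv => ?_⟩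
    rw [hcψ v hv]
    exact hψ v (Equiv.Perm.mem_support.1 (Equiv.Perm.mem_cycleFactorsFinset_support_le hc hv))
  · have hmem := hψ (Equiv.Perm.cycleOf_mem_cycleFactorsFinset_iff.2 (Equiv.Perm.mem_support.2 hv))
    simpa using ((hπ _).1 hmem).2 v (by simpa using hv)

theorem numDirectedCycles_eq_count (hπ : ∀ c, c ∈ π.cycleFactorsFinset ↔ IsDirectedCycle O c)
    (i : ℕ) : numDirectedCycles O i = π.cycleType.count i := by
  classical
  rw [numDirectedCycles, Equiv.Perm.cycleType_def, Multiset.count_map, ← Finset.filter_val,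
    Finset.card_val]
  congr 1
  ext c
  simp [hπ, eq_comm]

theorem hasType_iff (hπ : ∀ c, c ∈ π.cycleFactorsFinset ↔ IsDirectedCycle O c)
    {mu : n.Partition} : HasType O mu ↔ mu.parts.filter (2 ≤ ·) = π.cycleType := by
  simp only [HasType, numDirectedCycles_eq_count hπ, Multiset.ext, Multiset.count_filter]
  refine forall_congr' fun i => ?_
  split_ifs with hi
  · simp only [hi, forall_const]
  · have hcount : π.cycleType.count i = 0 :=
      Multiset.count_eq_zero.2 fun hmem => hi (Equiv.Perm.two_le_of_mem_cycleType hmem)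
    simp only [hi, hcount, IsEmpty.forall_iff]

theorem parts_eq_filter_add_replicate (mu : n.Partition) :
    mu.parts = mu.parts.filter (2 ≤ ·) +
      Multiset.replicate (n - (mu.parts.filter (2 ≤ ·)).sum) 1 := by
  have hone : mu.parts.filter (¬2 ≤ ·) =
      Multiset.replicate (mu.parts.filter (¬2 ≤ ·)).card 1 := by
    refine Multiset.eq_replicate_card.2 fun i hi => ?_
    have hpos := mu.parts_pos (Multiset.mem_of_mem_filter hi)
    have hlt := Multiset.of_mem_filter hi
    omega
  have hsum := congrArg Multiset.sum (Multiset.filter_add_not (2 ≤ ·) mu.parts)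
  rw [Multiset.sum_add, hone, Multiset.sum_replicate, mu.parts_sum, smul_eq_mul, mul_one] at hsum
  rw [Nat.sub_eq_of_eq_add' hsum.symm, ← hone, Multiset.filter_add_not]

theorem existsUnique_filter_parts_eq_cycleType (π : Equiv.Perm (Fin n)) :
    ∃! mu : n.Partition, mu.parts.filter (2 ≤ ·) = π.cycleType := by
  have hex : ∃ mu : (Fintype.card (Fin n)).Partition, mu.parts.filter (2 ≤ ·) = π.cycleType :=
    ⟨π.partition, Equiv.Perm.filter_parts_partition_eq_cycleType⟩
  rw [Fintype.card_fin] at hex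
  refine existsUnique_of_exists_of_unique hex fun mu nu hmu hnu => ?_
  rw [Nat.Partition.ext_iff, parts_eq_filter_add_replicate mu, parts_eq_filter_add_replicate nu,
    hmu, hnu]

theorem existsUnique_hasType (O : Fin n → Option (Fin n)) : ∃! mu : n.Partition, HasType O mu := by
  obtain ⟨π, hπ⟩ := exists_mem_cycleFactorsFinset_iff_isDirectedCycle O
  simpa only [hasType_iff hπ] using existsUnique_filter_parts_eq_cycleType π

theorem exists_cycleType_eq_filter_parts (mu : n.Partition) :
    ∃ π : Equiv.Perm (Fin n), π.cycleType = mu.parts.filter (2 ≤ ·) := by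
  refine (Equiv.Perm.exists_with_cycleType_iff _).2 ⟨?_, fun i => Multiset.of_mem_filter⟩
  rw [Fintype.card_fin]
  conv_rhs => rw [← mu.parts_sum, ← Multiset.filter_add_not (2 ≤ ·) mu.parts, Multiset.sum_add]
  exact Nat.le_add_right _ _

theorem HasType.sum_follows_eq {M : Type*} [AddCommMonoid M] {mu : n.Partition}
    (hO : HasType O mu) (F : Multiset ℕ → M) [DecidablePred (Follows O)] :
    ∑ ψ with Follows O ψ, F ψ.cycleType = ((mu.parts.filter (2 ≤ ·)).powerset.map F).sum := by
  obtain ⟨π, hπ⟩ := exists_mem_cycleFactorsFinset_iff_isDirectedCycle O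
  simp only [follows_iff_cycleFactorsFinset_subset hπ]
  rw [(hasType_iff hπ).1 hO, sum_cycleType]

end DirectedCycleFactors

section SpechtModule

variable {n : ℕ} (lam : n.Partition)

/-- The action of the symmetric group on the Specht module, whose character is `irrChar`. -/
noncomputable def spechtRep : Representation ℂ (Equiv.Perm (Fin n)) (spechtModule lam) :=
  (tabloidRep n).subrepresentation (spechtModule lam) (tabloidRep_mem_spechtModule lam)

theorem irrChar_eq_trace (σ : Equiv.Perm (Fin n)) :
    irrChar lam σ = LinearMap.trace ℂ (spechtModule lam) (spechtRep lam σ) := rfl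

theorem irrChar_eq_of_cycleType_eq {σ τ : Equiv.Perm (Fin n)} (h : σ.cycleType = τ.cycleType) :
    irrChar lam σ = irrChar lam τ := by
  obtain ⟨c, rfl⟩ := isConj_iff.1 (Equiv.Perm.isConj_iff_cycleType_eq.2 h)
  simp only [irrChar_eq_trace, map_mul]
  rw [LinearMap.trace_mul_comm, ← mul_assoc, ← map_mul, inv_mul_cancel, map_one, one_mul]

theorem exists_irrChar_eq_apply_cycleType :
    ∃ F : Multiset ℕ → ℂ, ∀ σ, irrChar lam σ = F σ.cycleType := by
  have hfactors : Function.FactorsThrough (irrChar lam) Equiv.Perm.cycleType :=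
    fun _ _ => irrChar_eq_of_cycleType_eq lam
  obtain ⟨F, hF⟩ := (Function.factorsThrough_iff _).1 hfactors
  exact ⟨F, congrFun hF⟩

instance finiteDimensional_spechtModule : FiniteDimensional ℂ (spechtModule lam) := by
  have : Finite {c : ℕ × ℕ // c ∈ partitionDiagram lam} := (partitionDiagram lam).cells.finite_toSet
  exact FiniteDimensional.span_of_finite ℂ (Set.finite_range _)

open ComplexOrder in
theorem sum_irrChar_mul_inv_nonneg (E : Finset (Equiv.Perm (Fin n))) :
    0 ≤ ∑ g ∈ E, ∑ h ∈ E, irrChar lam (g * h⁻¹) := by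
  simpa only [irrChar_eq_trace] using
    sum_trace_mul_inv_nonneg (W := spechtModule lam) (spechtRep lam) E

theorem exists_nonneg_sum_follows_irrChar : ∃ w : n.Partition → ℝ, (∀ mu, 0 ≤ w mu) ∧
    ∀ (O : Fin n → Option (Fin n)) [DecidablePred (Follows O)] (mu : n.Partition), HasType O mu →
      ∑ ψ with Follows O ψ, irrChar lam ψ = w mu := by
  obtain ⟨F, hF⟩ := exists_irrChar_eq_apply_cycleType lam
  let weight (mu : n.Partition) : ℂ := ((mu.parts.filter (2 ≤ ·)).powerset.map F).sum
  have hnonneg (mu : n.Partition) : 0 ≤ (weight mu).re ∧ 0 = (weight mu).im := by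
    obtain ⟨π, hπ⟩ := exists_cycleType_eq_filter_parts mu
    have h := sum_powerset_cycleType_nonneg
      (by simpa only [hF] using sum_irrChar_mul_inv_nonneg lam) π
    rwa [hπ, Complex.nonneg_iff] at h
  refine ⟨fun mu => (weight mu).re, fun mu => (hnonneg mu).1, fun O _ mu hO => ?_⟩
  simp only [hF, hO.sum_follows_eq F]
  exact Complex.ext rfl (hnonneg mu).2.symm

end SpechtModule

section Expansion

theorem prod_elim_X_neg_one {V R : Type*} [Fintype V] [CommRing R] (O : V → Option V) :
    ∏ v, (O v).elim X (fun _ => (-1 : R[X])) =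
      (-1) ^ Fintype.card {v // (O v).isSome} *
        X ^ (Fintype.card V - Fintype.card {v // (O v).isSome}) := by
  classical
  have helim (v : V) : (O v).elim X (fun _ => (-1 : R[X])) = if (O v).isSome then -1 else X := by
    cases O v <;> rfl
  simp only [helim]
  rw [Finset.prod_ite, Finset.prod_const, Finset.prod_const, ← Finset.compl_filter,
    Finset.card_compl, Fintype.card_subtype]

variable {V R : Type*} [Fintype V] [DecidableEq V] [CommRing R]

/-- The signless Laplacian `D + A` of a graph. On bipartite graphs it has the same immanantal
polynomials as the Laplacian, but its entries have no cancelling signs. -/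
def signlessLapMatrix (R : Type*) [CommRing R] (G : SimpleGraph V) [DecidableRel G.Adj] :
    Matrix V V R :=
  G.degMatrix R + G.adjMatrix R

open Classical in
/-- The ways of placing `r` arrows along edges of `G`, at most one at each vertex: all
`B`-orientations of `G` with `|B| = r`, of any type. -/
noncomputable def arrowPlacements (G : SimpleGraph V) (r : ℕ) : Finset (V → Option V) :=
  {O | (∀ v, ∀ w ∈ O v, G.Adj v w) ∧ Fintype.card {v // (O v).isSome} = r}

variable (G : SimpleGraph V) [DecidableRel G.Adj]

/-- Each choice of `o` is a possible arrow at `v`: no arrow contributes `X`, an arrow contributes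
`-1`, and off the diagonal the arrow is forced to point to `u`. -/
theorem charmatrix_signlessLapMatrix_apply (v u : V) :
    (signlessLapMatrix R G).charmatrix v u =
      ∑ o : Option V, if (∀ w ∈ o, G.Adj v w) ∧ (u ≠ v → o = some u) then
        o.elim X fun _ => -1 else 0 := by
  rcases eq_or_ne u v with rfl | huv
  · rw [Fintype.sum_option]
    simp [signlessLapMatrix, SimpleGraph.degMatrix, Finset.sum_ite, sub_eq_add_neg,
      ← SimpleGraph.card_neighborFinset_eq_degree, SimpleGraph.neighborFinset_eq_filter]
  · rw [Fintype.sum_eq_single (some u) fun o ho => if_neg fun h => ho (h.2 huv)]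
    simp [signlessLapMatrix, SimpleGraph.degMatrix, huv.symm, apply_ite C, neg_ite]

theorem prod_charmatrix_signlessLapMatrix (ψ : Equiv.Perm V)
    [DecidablePred fun O : V → Option V => (∀ v, ∀ w ∈ O v, G.Adj v w) ∧ Follows O ψ] :
    ∏ v, (signlessLapMatrix R G).charmatrix v (ψ v) =
      ∑ O with (∀ v, ∀ w ∈ O v, G.Adj v w) ∧ Follows O ψ, ∏ v, (O v).elim X fun _ => -1 := by
  simp only [charmatrix_signlessLapMatrix_apply, Finset.prod_univ_sum, Fintype.piFinset_univ,
    Finset.prod_ite_zero, Finset.mem_univ, forall_const, forall_and, Finset.sum_filter]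
  exact Finset.sum_congr rfl fun O _ => if_congr Iff.rfl rfl rfl

open Classical in
theorem coeff_prod_charmatrix_signlessLapMatrix (ψ : Equiv.Perm V) {r : ℕ}
    (hr : r ≤ Fintype.card V) :
    (∏ v, (signlessLapMatrix R G).charmatrix v (ψ v)).coeff (Fintype.card V - r) =
      (-1) ^ r * (Finset.card {O ∈ arrowPlacements G r | Follows O ψ} : R) := by
  have hterm (O : V → Option V) : (∏ v, (O v).elim X fun _ => (-1 : R[X])).coeff
      (Fintype.card V - r) =
        if Fintype.card {v // (O v).isSome} = r then (-1) ^ r else 0 := by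
    have hcard := Fintype.card_subtype_le fun v => (O v).isSome = true
    rw [prod_elim_X_neg_one, ← C_1, ← C_neg, ← C_pow, coeff_C_mul_X_pow]
    exact ite_congr (by rw [eq_iff_iff]; omega) (fun h => by rw [h]) fun _ => rfl
  simp only [prod_charmatrix_signlessLapMatrix, finsetSum_coeff, hterm, arrowPlacements,
    ← Finset.sum_filter, Finset.filter_filter, and_right_comm, Finset.sum_const, nsmul_eq_mul,
    mul_comm]

end Expansion

section ImmanantalCoeff

variable {n : ℕ} {lam : n.Partition} {r : ℕ}

open Classical in
theorem immanantalCoeff_signlessLapMatrix_eq_sum (G : SimpleGraph (Fin n)) [DecidableRel G.Adj]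
    (hr : r ≤ n) :
    immanantalCoeff lam r (signlessLapMatrix ℂ G) =
      ∑ O ∈ arrowPlacements G r, ∑ ψ with Follows O ψ, irrChar lam ψ := by
  have hcoeff (ψ : Equiv.Perm (Fin n)) :
      (-1) ^ r * (∏ v, (signlessLapMatrix ℂ G).charmatrix v (ψ v)).coeff (n - r) =
        (Finset.card {O ∈ arrowPlacements G r | Follows O ψ} : ℂ) := by
    have h := coeff_prod_charmatrix_signlessLapMatrix (R := ℂ) G ψ (r := r)
    rw [Fintype.card_fin] at h
    rw [h hr, ← mul_assoc, ← mul_pow, neg_one_mul, neg_neg, one_pow, one_mul]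
  simp only [immanantalCoeff, immanantalPolynomial, immanant, finsetSum_coeff, coeff_smul,
    smul_eq_mul, Finset.mul_sum, mul_left_comm _ (irrChar lam _), hcoeff]
  simp only [Finset.sum_filter]
  rw [Finset.sum_comm]
  refine Finset.sum_congr rfl fun ψ _ => ?_
  rw [← Finset.sum_filter, Finset.sum_const, nsmul_eq_mul, mul_comm]

theorem mem_orientations_iff {G : SimpleGraph (Fin n)} {mu : n.Partition}
    {O : Fin n → Option (Fin n)} :
    O ∈ orientations G r mu ↔ O ∈ arrowPlacements G r ∧ HasType O mu := by
  simp only [orientations, arrowPlacements, Finset.mem_filter_univ]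
  refine and_congr_left fun _ => ⟨?_, ?_⟩
  · rintro ⟨B, rfl, hB, hadj⟩
    exact ⟨hadj, Fintype.card_of_subtype B fun v => (hB v).symm⟩
  · rintro ⟨hadj, hcard⟩
    exact ⟨Finset.univ.filter fun v => (O v).isSome, by rwa [← Fintype.card_subtype], by simp, hadj⟩

theorem exists_nonneg_immanantalCoeff_signlessLapMatrix_eq (lam : n.Partition) :
    ∃ w : n.Partition → ℝ, (∀ mu, 0 ≤ w mu) ∧
      ∀ (G : SimpleGraph (Fin n)) [DecidableRel G.Adj] (r : ℕ), r ≤ n →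
        immanantalCoeff lam r (signlessLapMatrix ℂ G) =
          (∑ mu, numOrientations G r mu * w mu : ℝ) := by
  classical
  obtain ⟨w, hw, hsum⟩ := exists_nonneg_sum_follows_irrChar lam
  refine ⟨w, hw, fun G _ r hr => ?_⟩
  choose type htype huniq using existsUnique_hasType (n := n)
  have hfiber (mu : n.Partition) :
      {O ∈ arrowPlacements G r | type O = mu} = orientations G r mu := by
    ext O
    rw [Finset.mem_filter, mem_orientations_iff]
    exact and_congr_right fun _ => ⟨fun h => h ▸ htype O, fun h => (huniq O mu h).symm⟩
  rw [immanantalCoeff_signlessLapMatrix_eq_sum G hr, ← Finset.sum_fiberwise _ type,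
    Complex.ofReal_sum]
  refine Finset.sum_congr rfl fun mu _ => ?_
  rw [hfiber, Finset.sum_congr rfl fun O hO => hsum O mu (mem_orientations_iff.1 hO).2,
    Finset.sum_const, nsmul_eq_mul, numOrientations, Complex.ofReal_mul,
    Complex.ofReal_natCast]

theorem immanantalCoeff_diagonal_mul_mul_diagonal {d e : Fin n → ℂ} (hde : ∀ i, d i * e i = 1)
    (A : Matrix (Fin n) (Fin n) ℂ) :
    immanantalCoeff lam r (Matrix.diagonal d * A * Matrix.diagonal e) =
      immanantalCoeff lam r A := by
  have hentry (i j : Fin n) : (Matrix.diagonal d * A * Matrix.diagonal e).charmatrix i j =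
      C (d i * e j) * A.charmatrix i j := by
    rcases eq_or_ne i j with rfl | hij
    · simp only [Matrix.charmatrix_apply_eq, Matrix.mul_diagonal, Matrix.diagonal_mul,
        mul_right_comm, hde, one_mul, C_1]
    · simp only [Matrix.charmatrix_apply_ne _ _ _ hij, Matrix.mul_diagonal, Matrix.diagonal_mul,
        mul_right_comm (d i), C_mul, mul_neg]
  have hscale (ψ : Equiv.Perm (Fin n)) : ∏ i, C (d i * e (ψ i)) = (1 : ℂ[X]) := by
    rw [← map_prod, Finset.prod_mul_distrib, Equiv.prod_comp ψ e, ← Finset.prod_mul_distrib,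
      Finset.prod_congr rfl fun i _ => hde i, Finset.prod_const_one, C_1]
  simp only [immanantalCoeff, immanantalPolynomial, immanant, hentry, Finset.prod_mul_distrib,
    hscale, one_mul]

theorem exists_lapMatrix_eq_diagonal_mul_mul_diagonal {V : Type*} [Fintype V] [DecidableEq V]
    (R : Type*) [CommRing R] {G : SimpleGraph V} [DecidableRel G.Adj] (hG : G.IsBipartite) :
    ∃ d : V → R, (∀ v, d v * d v = 1) ∧
      G.lapMatrix R = Matrix.diagonal d * signlessLapMatrix R G * Matrix.diagonal d := by
  obtain ⟨color⟩ := hG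
  let d (v : V) : R := (-1) ^ (color v : ℕ)
  have hsq (v : V) : d v * d v = 1 := by rw [← mul_pow, neg_one_mul, neg_neg, one_pow]
  have hadj {u v : V} (h : G.Adj u v) : d u * d v = -1 := by
    have hne := color.valid h
    have hcolor : (color u : ℕ) + color v = 1 := by omega
    rw [← pow_add, hcolor, pow_one]
  refine ⟨d, hsq, ?_⟩
  ext u v
  rw [Matrix.mul_diagonal, Matrix.diagonal_mul, mul_right_comm, signlessLapMatrix,
    SimpleGraph.lapMatrix, Matrix.sub_apply, Matrix.add_apply, SimpleGraph.adjMatrix_apply]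
  rcases eq_or_ne u v with rfl | huv
  · simp [hsq]
  · split_ifs with h
    · simp [hadj h, SimpleGraph.degMatrix, huv]
    · simp [SimpleGraph.degMatrix, huv]

theorem immanantalCoeff_lapMatrix {G : SimpleGraph (Fin n)} [DecidableRel G.Adj]
    (hG : G.IsBipartite) :
    immanantalCoeff lam r (G.lapMatrix ℂ) = immanantalCoeff lam r (signlessLapMatrix ℂ G) := by
  obtain ⟨d, hd, heq⟩ := exists_lapMatrix_eq_diagonal_mul_mul_diagonal ℂ hG
  rw [heq, immanantalCoeff_diagonal_mul_mul_diagonal hd]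

end ImmanantalCoeff

theorem theorem5p3_general {n : ℕ} {G₁ G₂ : SimpleGraph (Fin n)} [DecidableRel G₁.Adj]
    [DecidableRel G₂.Adj] (hG : IsGGS G₁ G₂) :
    (∀ (r : ℕ) (mu : n.Partition), numOrientations G₂ r mu ≤ numOrientations G₁ r mu) ∧
      ∀ (lam : n.Partition) (r : ℕ), r ≤ n →
        (immanantalCoeff lam r (signlessLapMatrix ℂ G₁)).im = 0 ∧
        (immanantalCoeff lam r (signlessLapMatrix ℂ G₂)).im = 0 ∧
        (immanantalCoeff lam r (signlessLapMatrix ℂ G₂)).re ≤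
          (immanantalCoeff lam r (signlessLapMatrix ℂ G₁)).re := by
  have hle := hG.numOrientations_le
  refine ⟨hle, fun lam r hr => ?_⟩
  obtain ⟨w, hw, hcoeff⟩ := exists_nonneg_immanantalCoeff_signlessLapMatrix_eq lam
  simp only [hcoeff G₁ r hr, hcoeff G₂ r hr, Complex.ofReal_im, Complex.ofReal_re, true_and]
  exact Finset.sum_le_sum fun mu _ =>
    mul_le_mul_of_nonneg_right (Nat.cast_le.2 (hle r mu)) (hw mu)

/-- If `G₁`, `G₂` are bipartite and `G₂ = GGS(G₁)`, then `a_{G₂,r}(mu) ≤ a_{G₁,r}(mu)` for all `r`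
and all `mu ⊢ n`, and `b_{lam,r}(L_{G₂}) ≤ b_{lam,r}(L_{G₁})` for all `lam ⊢ n` and `0 ≤ r ≤ n`,
these coefficients being real numbers. -/
theorem theorem5p3 (n : ℕ) (G₁ G₂ : SimpleGraph (Fin n)) [DecidableRel G₁.Adj]
    [DecidableRel G₂.Adj] (h₁ : G₁.IsBipartite) (h₂ : G₂.IsBipartite) (hG : IsGGS G₁ G₂) :
    (∀ (r : ℕ) (mu : n.Partition), numOrientations G₂ r mu ≤ numOrientations G₁ r mu) ∧
    (∀ (lam : n.Partition) (r : ℕ), r ≤ n →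
      (immanantalCoeff lam r (G₁.lapMatrix ℂ)).im = 0 ∧
      (immanantalCoeff lam r (G₂.lapMatrix ℂ)).im = 0 ∧
      (immanantalCoeff lam r (G₂.lapMatrix ℂ)).re ≤
        (immanantalCoeff lam r (G₁.lapMatrix ℂ)).re) := by
  simpa only [immanantalCoeff_lapMatrix h₁, immanantalCoeff_lapMatrix h₂] using
    theorem5p3_general hG
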